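/- Let $q=1$ and let $V$ be a finite set with $n$ elements, or let $q\ge 2$ be a prime power and let $V$ be an $\mathbb{F}_q$-vector space of finite dimension $n$. Let $\mathcal{L}(V)$ be the lattice of all subsets (if $q=1$) or all subspaces (if $q\ge 2$) of $V$, and write $\operatorname{rk}$ for cardinality or dimension, respectively. Let $\left[{V\atop k}\right]$ be the set of all $K\in\mathcal{L}(V)$ with $\operatorname{rk}K=k$; its elements are called $k$-subspaces. For $I\in\mathcal{L}(V)$ let $\boldsymbol{x}_I^{(k)}:\left[{V\atop k}\right]\to\mathbb{R}$ be the function with value $1$ at $K$ if $I\le K$ and value $0$ otherwise. Let $\bar V_i^{(k)}$ be the real vector space spanned by the functions $\boldsymbol{x}_I^{(k)}$ with $I\in\left[{V\atop i}\right]$. For $f:\left[{V\atop k}\right]\to\mathbb{R}$ with $f\ne 0$, let $\deg(f)$ be the smallest $t\in\{0,\dots,\min(k,n-k)\}$ with $f\in\bar V_t^{(k)}$; put $\deg(0)=-\infty$. Let $U\mapsto U^\perp$ be an anti-automorphism of the lattice $\mathcal{L}(V)$. It maps $(n-k)$-subspaces to $k$-subspaces. For $f:\left[{V\atop k}\right]\to\mathbb{R}$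 let $f^\perp:\left[{V\atop n-k}\right]\to\mathbb{R}$ be given by $f^\perp(K)=f(K^\perp)$, and for a set $S$ of such functions let $S^\perp=\{f^\perp\mid f\in S\}$. **Theorem.** For all $k\in\{0,\dots,n\}$ and all $i\in\{0,\dots,\min(k,n-k)\}$, $$\bigl(\bar V_i^{(k)}\bigr)^\perp=\bar V_i^{(n-k)}.$$ In other words, for every $k\in\{0,\dots,n\}$ and every $f:\left[{V\atop k}\right]\to\mathbb{R}$ the degree is well defined (there is $t\in\{0,\dots,\min(k,n-k)\}$ with $f\in\bar V_t^{(k)}$) and $\deg(f^\perp)=\deg(f)$. -/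

import Mathlib

/-! Both cases are treated uniformly through a poset `L` with a rank function `rk : L → ℕ`:
`L = Finset V` with `rk = Finset.card` (the set case, `q = 1`), and `L = Submodule F V` with
`rk U = Module.finrank F U` over a finite field `F` (the `q`-analog case, `q = #F ≥ 2`). -/

namespace DegreeDual

/-- The elements of rank `k`, that is, the "`k`-subspaces". -/
def Level {L : Type*} (rk : L → ℕ) (k : ℕ) : Type _ := {U : L // rk U = k}

open Classical in
/-- The characteristic function on the `k`-subspaces of the pencil `{K | U ≤ K}`. -/
noncomputable def pencil {L : Type*} [PartialOrder L] (rk : L → ℕ) (k : ℕ) (U : L) :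
    Level rk k → ℝ :=
  fun K => if U ≤ K.1 then 1 else 0

/-- The space of functions on `k`-subspaces spanned by the `i`-pencils, that is, the row space
of the incidence matrix of `i`-subspaces versus `k`-subspaces. -/
noncomputable def pencilSpace {L : Type*} [PartialOrder L] (rk : L → ℕ) (i k : ℕ) :
    Submodule ℝ (Level rk k → ℝ) :=
  Submodule.span ℝ (Set.range fun I : Level rk i => pencil rk k I.1)

open Classical in
/-- The degree of a function on the `k`-subspaces of an ambient space of rank `n`: the smallest
`t ∈ {0, …, min k (n - k)}` such that `f` is in the span of the `t`-pencils; it is `-∞` for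
`f = 0`. -/
noncomputable def degree {L : Type*} [PartialOrder L] (rk : L → ℕ) (n k : ℕ)
    (f : Level rk k → ℝ) : WithBot ℕ :=
  if f = 0 then ⊥ else ((sInf {t : ℕ | t ≤ min k (n - k) ∧ f ∈ pencilSpace rk t k} : ℕ) : WithBot ℕ)

/-- The dualized function `K ↦ f (K^⊥)` on the `(n - k)`-subspaces, where `perp` is an
anti-automorphism (an order isomorphism onto the order dual); `hperp` (proved below in both
cases) makes `K^⊥` a `k`-subspace. -/
def dualize {L : Type*} [PartialOrder L] {rk : L → ℕ} {n k : ℕ} (perp : L ≃o Lᵒᵈ)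
    (hperp : ∀ U : L, rk (OrderDual.ofDual (perp U)) + rk U = n) (hk : k ≤ n)
    (f : Level rk k → ℝ) : Level rk (n - k) → ℝ :=
  fun K => f ⟨OrderDual.ofDual (perp K.1), by
    have h1 := hperp K.1
    have h2 := K.2
    omega⟩

/-- The up-set of `U` corresponds to the down-set of `U^⊥`. -/
def upDown {L : Type*} [PartialOrder L] (perp : L ≃o Lᵒᵈ) (U : L) :
    Set.Ici U ≃o (Set.Iic (OrderDual.ofDual (perp U)))ᵒᵈ where
  toFun X := OrderDual.toDual ⟨OrderDual.ofDual (perp X.1), perp.monotone X.2⟩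
  invFun Y := ⟨perp.symm (OrderDual.toDual (OrderDual.ofDual Y).1), by
    rw [Set.mem_Ici, perp.le_symm_apply]
    exact (OrderDual.ofDual Y).2⟩
  left_inv X := Subtype.ext (perp.symm_apply_apply X.1)
  right_inv Y := OrderDual.ofDual.injective (Subtype.ext
    (congrArg OrderDual.ofDual
      (perp.apply_symm_apply (OrderDual.toDual (OrderDual.ofDual Y).1))))
  map_rel_iff' {X Y} := perp.map_rel_iff (a := X.1) (b := Y.1)

/-- An anti-automorphism of the subset lattice sends `k`-sets to `(n - k)`-sets. -/
theorem card_perp {V : Type*} [Fintype V] (perp : Finset V ≃o (Finset V)ᵒᵈ) (U : Finset V) :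
    (OrderDual.ofDual (perp U)).card + U.card = Fintype.card V := by
  classical
  have h := Nat.card_congr (upDown perp U).toEquiv
  have h1 : Nat.card (Set.Ici U) = 2 ^ (Fintype.card V - U.card) := by
    have : (Set.Ici U) = ((Finset.Icc U Finset.univ : Finset (Finset V)) : Set (Finset V)) := by
      ext X; simp
    rw [this, Nat.card_coe_set_eq, Set.ncard_coe_finset,
      Finset.card_Icc_finset (Finset.subset_univ U), Finset.card_univ]
  have h2 : Nat.card (Set.Iic (OrderDual.ofDual (perp U)))ᵒᵈ
      = 2 ^ (OrderDual.ofDual (perp U)).card := by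
    have : (Set.Iic (OrderDual.ofDual (perp U)))
        = ((OrderDual.ofDual (perp U)).powerset : Set (Finset V)) := by
      ext X
      rw [Finset.mem_coe, Finset.mem_powerset]
      rfl
    change Nat.card (Set.Iic (OrderDual.ofDual (perp U))) = _
    rw [this, Nat.card_coe_set_eq, Set.ncard_coe_finset, Finset.card_powerset]
  rw [h1, h2] at h
  have h3 := Nat.pow_right_injective le_rfl h
  have h4 := Finset.card_le_univ U
  omega

/-- An anti-automorphism of the subspace lattice sends `k`-spaces to `(n - k)`-spaces. -/
theorem finrank_perp {F V : Type*} [Field F] [AddCommGroup V] [Module F V]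
    [FiniteDimensional F V] (perp : Submodule F V ≃o (Submodule F V)ᵒᵈ) (U : Submodule F V) :
    Module.finrank F (OrderDual.ofDual (perp U) : Submodule F V) + Module.finrank F U
      = Module.finrank F V := by
  have e1 : Submodule F (V ⧸ U) ≃o Set.Ici U := Submodule.comapMkQRelIso U
  have e2 : Submodule F (OrderDual.ofDual (perp U) : Submodule F V) ≃o
      Set.Iic (OrderDual.ofDual (perp U)) := Submodule.mapIic _
  have h : Order.krullDim (Submodule F (V ⧸ U)) =
      Order.krullDim (Submodule F (OrderDual.ofDual (perp U) : Submodule F V)) := by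
    rw [Order.krullDim_eq_of_orderIso e1, Order.krullDim_eq_of_orderIso e2,
      Order.krullDim_eq_of_orderIso (upDown perp U), Order.krullDim_orderDual]
  rw [← Module.coe_length, ← Module.coe_length, Module.length_eq_finrank,
    Module.length_eq_finrank] at h
  have h5 : Module.finrank F (V ⧸ U)
      = Module.finrank F (OrderDual.ofDual (perp U) : Submodule F V) := by exact_mod_cast h
  rw [← h5]
  exact Submodule.finrank_quotient_add_finrank U

/-- The rank function of the subspace lattice. -/
noncomputable def dimRk (F V : Type*) [Field F] [AddCommGroup V] [Module F V] :
    Submodule F V → ℕ :=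
  fun U => Module.finrank F U

/-- The rank function of the subset lattice. -/
def cardRk (V : Type*) : Finset V → ℕ := fun U => U.card

end DegreeDual

namespace DegreeDual

/-! Call a function on level `m` of degree at most `i` if it is a combination of pencils of rank at
most `i`. Since the product of two pencils is the pencil of the join, degrees add under
multiplication. If `H` is a coatom, the indicator of `K ≤ H` has degree at most 1: the number of
points below both `K` and `H` is a sum of point pencils and takes one value if `K ≤ H` and another
if not. A rank-`i` element `I` is a join of `i` points `p`, so `I ≤ K^⊥` is a conjunction of `i`
conditions of the form `K ≤ H`, and the dual of an `i`-pencil has degree at most `i`.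

For `i ≤ m`, averaging over points shows that pencils of lower rank lie in the span of the rank-`i`
pencils. This gives one inclusion; the inverse anti-automorphism gives the other. -/

/-- A lattice with a modular rank function and a finite family of points, such that the number of
points below an element is a strictly increasing function `N` of its rank. -/
structure PointRank {L V : Type*} [Lattice L] [OrderBot L] (rk : L → ℕ) (pt : V → L)
    (N : ℕ → ℕ) : Prop where
  modular : ∀ A B, rk (A ⊔ B) + rk (A ⊓ B) = rk A + rk B
  strictMono : StrictMono rk
  bot : rk ⊥ = 0
  pt_le_one : ∀ v, rk (pt v) ≤ 1
  exists_pt : ∀ A B, A < B → ∃ v, pt v ≤ B ∧ ¬ pt v ≤ A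
  card : ∀ K, Nat.card {v // pt v ≤ K} = N (rk K)
  strictMono_card : StrictMono N

/-- The span of the pencils of rank at most `i` on level `m`. -/
noncomputable def lowSpace {L : Type*} [PartialOrder L] (rk : L → ℕ) (i m : ℕ) :
    Submodule ℝ (Level rk m → ℝ) :=
  Submodule.span ℝ {f | ∃ U, rk U ≤ i ∧ f = pencil rk m U}

/-! ### Pencils and the filtration by rank -/

section
variable {L : Type*} [Lattice L] {rk : L → ℕ}

theorem pencil_mem_lowSpace {i : ℕ} (m : ℕ) {U : L} (hU : rk U ≤ i) :
    pencil rk m U ∈ lowSpace rk i m :=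
  Submodule.subset_span ⟨U, hU, rfl⟩

theorem pencil_mul (m : ℕ) (A B : L) :
    pencil rk m A * pencil rk m B = pencil rk m (A ⊔ B) := by
  funext K
  by_cases hA : A ≤ K.1 <;> by_cases hB : B ≤ K.1 <;> simp [pencil, hA, hB]

theorem dualize_bijective {n : ℕ} {e : L ≃o Lᵒᵈ}
    (he : ∀ U, rk (OrderDual.ofDual (e U)) + rk U = n) {k : ℕ} (hk : k ≤ n) :
    Function.Bijective (dualize (k := k) e he hk) := by
  have hsymm : ∀ K : Level rk k, rk (e.symm (OrderDual.toDual K.1)) = n - k := fun K => by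
    have h1 := he (e.symm (OrderDual.toDual K.1))
    have h2 := K.2
    rw [e.apply_symm_apply, OrderDual.ofDual_toDual] at h1
    omega
  refine Function.bijective_iff_has_inverse.2
    ⟨fun g K => g ⟨e.symm (OrderDual.toDual K.1), hsymm K⟩, fun f => ?_, fun g => ?_⟩
  · funext K
    refine congrArg f (Subtype.ext ?_)
    change OrderDual.ofDual (e (e.symm (OrderDual.toDual K.1))) = K.1
    rw [e.apply_symm_apply, OrderDual.ofDual_toDual]
  · funext K
    exact congrArg g (Subtype.ext (e.symm_apply_apply K.1))

variable [OrderBot L]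

theorem pencil_bot (m : ℕ) : pencil rk m (⊥ : L) = 1 := by
  funext K
  simp [pencil]

namespace PointRank
variable {V : Type*} {pt : V → L} {N : ℕ → ℕ}

/-- A join may have rank below the sum of the ranks, which is why `lowSpace` allows all ranks up to
a bound. -/
theorem mul_mem_lowSpace (h : PointRank rk pt N) {i j m : ℕ} {f g : Level rk m → ℝ}
    (hf : f ∈ lowSpace rk i m) (hg : g ∈ lowSpace rk j m) : f * g ∈ lowSpace rk (i + j) m := by
  have hfg := Submodule.mul_mem_mul hf hg
  rw [lowSpace, lowSpace, Submodule.span_mul_span] at hfg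
  refine Submodule.span_mono ?_ hfg
  rintro _ ⟨_, ⟨A, hA, rfl⟩, _, ⟨B, hB, rfl⟩, rfl⟩
  have := h.modular A B
  exact ⟨A ⊔ B, by omega, pencil_mul m A B⟩

theorem rk_sup_pt (h : PointRank rk pt N) {S : L} {v : V} (hv : ¬ pt v ≤ S) :
    rk (S ⊔ pt v) = rk S + 1 := by
  have h1 := h.modular S (pt v)
  have h2 := h.pt_le_one v
  have h3 := h.strictMono (left_lt_sup.2 hv)
  omega

theorem exists_le_rk (h : PointRank rk pt N) (I : L) {j : ℕ} (hj : j ≤ rk I) :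
    ∃ J ≤ I, rk J = j := by
  induction j with
  | zero => exact ⟨⊥, bot_le, h.bot⟩
  | succ j ih =>
    obtain ⟨J, hJI, hJ⟩ := ih (by omega)
    have hlt : J < I := lt_of_le_of_ne hJI (by rintro rfl; omega)
    obtain ⟨v, hv, hv'⟩ := h.exists_pt J I hlt
    exact ⟨J ⊔ pt v, sup_le hJI hv, by rw [h.rk_sup_pt hv', hJ]⟩

theorem exists_eq_sup_pt (h : PointRank rk pt N) {I : L} {i : ℕ} (hI : rk I = i + 1) :
    ∃ J v, rk J = i ∧ rk (pt v) = 1 ∧ I = J ⊔ pt v := by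
  obtain ⟨J, hJI, hJ⟩ := h.exists_le_rk I (j := i) (by omega)
  have hlt : J < I := lt_of_le_of_ne hJI (by rintro rfl; omega)
  obtain ⟨v, hv, hv'⟩ := h.exists_pt J I hlt
  have hr := h.rk_sup_pt hv'
  have hm := h.modular J (pt v)
  have h1 := h.pt_le_one v
  refine ⟨J, v, hJ, by omega, ?_⟩
  by_contra hne
  have := h.strictMono (lt_of_le_of_ne (sup_le hJI hv) (Ne.symm hne))
  omega

/-- Sum the pencils of `S ⊔ pt v` over all `v` with `pt v` not below `S`. At `K ≥ S` the sum counts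
the `v` with `pt v` below `K` but not below `S`, which is `N m - N i`, nonzero as `i < m`; at other
`K` every term vanishes. -/
theorem pencil_mem_pencilSpace_succ [Finite V] (h : PointRank rk pt N) {i m : ℕ} (him : i < m)
    {S : L} (hS : rk S = i) : pencil rk m S ∈ pencilSpace rk (i + 1) m := by
  classical
  have := Fintype.ofFinite V
  have hN : (0 : ℝ) < (N m : ℝ) - N i := sub_pos.2 (by exact_mod_cast h.strictMono_card him)
  have key : pencil rk m S = ((N m : ℝ) - N i)⁻¹ •
      ∑ v with ¬ pt v ≤ S, pencil rk m (S ⊔ pt v) := by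
    funext K
    rw [Pi.smul_apply, Finset.sum_apply, smul_eq_mul]
    by_cases hK : S ≤ K.1
    · have hcount : ({v | ¬ pt v ≤ S ∧ pt v ≤ K.1} : Finset V).card + N i = N m := by
        rw [← hS, ← congrArg N K.2, ← h.card, ← h.card, Nat.card_eq_fintype_card, Nat.card_eq_fintype_card,
          Fintype.card_subtype, Fintype.card_subtype, ← Finset.card_union_of_disjoint]
        · congr 1
          ext v
          simp only [Finset.mem_union, Finset.mem_filter, Finset.mem_univ, true_and]
          have : pt v ≤ S → pt v ≤ K.1 := fun hv => hv.trans hK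
          tauto
        · rw [Finset.disjoint_left]
          intro v
          simp +contextual
      have hsum : ∑ v with ¬ pt v ≤ S, pencil rk m (S ⊔ pt v) K = (N m : ℝ) - N i := by
        simp only [pencil, sup_le_iff, hK, true_and]
        rw [Finset.sum_boole, Finset.filter_filter, eq_sub_iff_add_eq]
        exact_mod_cast hcount
      rw [hsum, inv_mul_cancel₀ hN.ne']
      simp [pencil, hK]
    · simp [pencil, hK]
  rw [key]
  refine Submodule.smul_mem _ _ (Submodule.sum_mem _ fun v hv => Submodule.subset_span ?_)
  exact ⟨⟨S ⊔ pt v, by rw [h.rk_sup_pt (Finset.mem_filter.1 hv).2, hS]⟩, rfl⟩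

/-- The bound `i ≤ m` is essential: pencils of rank above `m` vanish on level `m`. -/
theorem lowSpace_le_pencilSpace [Finite V] (h : PointRank rk pt N) {i m : ℕ} (him : i ≤ m) :
    lowSpace rk i m ≤ pencilSpace rk i m := by
  have mono : ∀ j < m, pencilSpace rk j m ≤ pencilSpace rk (j + 1) m := by
    intro j hj
    refine Submodule.span_le.2 ?_
    rintro _ ⟨S, rfl⟩
    exact h.pencil_mem_pencilSpace_succ hj S.2
  refine Submodule.span_le.2 ?_
  rintro _ ⟨U, hU, rfl⟩
  have : ∀ j, rk U ≤ j → j ≤ m → pencil rk m U ∈ pencilSpace rk j m := by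
    intro j hj
    induction j, hj using Nat.le_induction with
    | base => exact fun _ => Submodule.subset_span ⟨⟨U, rfl⟩, rfl⟩
    | succ j _ ih => exact fun hjm => mono j (by omega) (ih (by omega))
  exact this i hU him

/-! ### Duals of pencils -/

variable {n : ℕ} {e : L ≃o Lᵒᵈ}

-- By modularity `K ⊓ H` is `K` or has rank `m - 1`, so the number of points below it is an affine
-- function of the indicator.
open Classical in
theorem coatom_mem_lowSpace [Finite V] (h : PointRank rk pt N) (hn : ∀ U, rk U ≤ n) (m : ℕ)
    {H : L} (hH : rk H + 1 = n) :
    (fun K : Level rk m => if K.1 ≤ H then (1 : ℝ) else 0) ∈ lowSpace rk 1 m := by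
  have := Fintype.ofFinite V
  have hone : (1 : Level rk m → ℝ) ∈ lowSpace rk 1 m := by
    rw [← pencil_bot]
    exact pencil_mem_lowSpace m (by rw [h.bot]; omega)
  -- Level 0 has no rank `m - 1` to compare with; there `K = ⊥` and the indicator is constantly 1.
  obtain _ | m := m
  · convert hone using 1
    funext K
    have hK : K.1 = ⊥ := by
      by_contra hne
      have h1 := h.strictMono (bot_lt_iff_ne_bot.2 hne)
      have h2 := K.2
      omega
    simp [hK]
  have hN : (0 : ℝ) < (N (m + 1) : ℝ) - N m :=
    sub_pos.2 (by exact_mod_cast h.strictMono_card (Nat.lt_succ_self m))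
  have key : (fun K : Level rk (m + 1) => if K.1 ≤ H then (1 : ℝ) else 0) =
      ((N (m + 1) : ℝ) - N m)⁻¹ •
        (∑ v with pt v ≤ H, pencil rk (m + 1) (pt v) - (N m : ℝ) • 1) := by
    funext K
    have hsum : ∑ v with pt v ≤ H, pencil rk (m + 1) (pt v) K = N (rk (K.1 ⊓ H)) := by
      simp only [pencil]
      rw [Finset.sum_boole, Finset.filter_filter, ← h.card, Nat.card_eq_fintype_card,
        Fintype.card_subtype]
      simp only [le_inf_iff, and_comm]
    simp only [Pi.smul_apply, Pi.sub_apply, Finset.sum_apply, hsum, Pi.one_apply, smul_eq_mul,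
      mul_one]
    by_cases hK : K.1 ≤ H
    · rw [inf_eq_left.2 hK, K.2, inv_mul_cancel₀ hN.ne', if_pos hK]
    · have h1 := h.modular K.1 H
      have h2 := h.strictMono (right_lt_sup.2 hK)
      have h3 := hn (K.1 ⊔ H)
      have h4 := K.2
      have h5 : rk (K.1 ⊓ H) = m := by omega
      simp [hK, h5]
  rw [key]
  refine Submodule.smul_mem _ _ (Submodule.sub_mem _ (Submodule.sum_mem _ fun v _ => ?_)
    (Submodule.smul_mem _ _ hone))
  exact pencil_mem_lowSpace _ (h.pt_le_one v)

open Classical in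
theorem dual_pencil_mem_lowSpace [Finite V] (h : PointRank rk pt N)
    (he : ∀ U, rk (OrderDual.ofDual (e U)) + rk U = n) (m : ℕ) {i : ℕ} {I : L} (hI : rk I = i) :
    (fun K : Level rk m => if I ≤ OrderDual.ofDual (e K.1) then (1 : ℝ) else 0)
      ∈ lowSpace rk i m := by
  have hn : ∀ U, rk U ≤ n := fun U => by have := he U; omega
  induction i generalizing I with
  | zero =>
    have hI' : I = ⊥ := by
      by_contra hne
      have h1 := h.strictMono (bot_lt_iff_ne_bot.2 hne)
      omega
    convert pencil_mem_lowSpace (rk := rk) m (U := (⊥ : L)) (i := 0) h.bot.le using 1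
    rw [pencil_bot]
    funext K
    simp [hI']
  | succ i ih =>
    obtain ⟨J, v, hJ, hv, rfl⟩ := h.exists_eq_sup_pt hI
    -- As `e` need not be an involution, the coatom belonging to the point comes from `e.symm`.
    have hH : rk (e.symm (OrderDual.toDual (pt v))) + 1 = n := by
      have := he (e.symm (OrderDual.toDual (pt v)))
      rw [e.apply_symm_apply, OrderDual.ofDual_toDual] at this
      omega
    convert h.mul_mem_lowSpace (ih hJ) (h.coatom_mem_lowSpace hn m hH) using 1
    funext K
    have hle : K.1 ≤ e.symm (OrderDual.toDual (pt v)) ↔ pt v ≤ OrderDual.ofDual (e K.1) :=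
      e.le_symm_apply
    simp only [Pi.mul_apply, hle, sup_le_iff]
    by_cases h1 : J ≤ OrderDual.ofDual (e K.1) <;>
      by_cases h2 : pt v ≤ OrderDual.ofDual (e K.1) <;> simp [h1, h2]

-- The map `φ` is left free so that the result applies to both `e` and its inverse.
open Classical in
theorem comp_perp_mem_pencilSpace [Finite V] (h : PointRank rk pt N)
    (he : ∀ U, rk (OrderDual.ofDual (e U)) + rk U = n) {i k m : ℕ} (him : i ≤ m)
    (φ : Level rk m → Level rk k) (hφ : ∀ K, (φ K).1 = OrderDual.ofDual (e K.1))
    {g : Level rk k → ℝ} (hg : g ∈ pencilSpace rk i k) : g ∘ φ ∈ pencilSpace rk i m := by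
  have hle : pencilSpace rk i k ≤ (pencilSpace rk i m).comap (LinearMap.funLeft ℝ ℝ φ) := by
    refine Submodule.span_le.2 ?_
    rintro _ ⟨I, rfl⟩
    refine h.lowSpace_le_pencilSpace him ?_
    convert h.dual_pencil_mem_lowSpace he m I.2 using 1
    funext K
    change (if I.1 ≤ (φ K).1 then (1 : ℝ) else 0) = _
    rw [hφ]
  exact hle hg

theorem dualize_mem_iff [Finite V] (h : PointRank rk pt N)
    (he : ∀ U, rk (OrderDual.ofDual (e U)) + rk U = n) {i k : ℕ} (hk : k ≤ n)
    (hi : i ≤ min k (n - k)) (f : Level rk k → ℝ) :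
    dualize e he hk f ∈ pencilSpace rk i (n - k) ↔ f ∈ pencilSpace rk i k := by
  constructor
  · intro hf
    -- The inverse anti-automorphism; composing with it undoes `dualize`.
    let e' : L ≃o Lᵒᵈ := (OrderIso.dualDual L).trans e.symm.dual
    have he'_apply : ∀ U, OrderDual.ofDual (e' U) = e.symm (OrderDual.toDual U) := fun U => rfl
    have he' : ∀ U, rk (OrderDual.ofDual (e' U)) + rk U = n := by
      intro U
      have := he (e.symm (OrderDual.toDual U))
      rw [e.apply_symm_apply, OrderDual.ofDual_toDual] at this
      rw [he'_apply]
      omega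
    let ψ : Level rk k → Level rk (n - k) := fun K => ⟨OrderDual.ofDual (e' K.1), by
      have h1 := he' K.1
      have h2 := K.2
      omega⟩
    convert h.comp_perp_mem_pencilSpace he' (le_trans hi (min_le_left _ _)) ψ (fun _ => rfl) hf
      using 1
    funext K
    refine congrArg f (Subtype.ext ?_)
    change K.1 = OrderDual.ofDual (e (e.symm (OrderDual.toDual K.1)))
    rw [e.apply_symm_apply, OrderDual.ofDual_toDual]
  · exact h.comp_perp_mem_pencilSpace he (le_trans hi (min_le_right _ _)) _ (fun _ => rfl)

/-! ### The degree -/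

theorem mem_pencilSpace_self (h : PointRank rk pt N) [Finite L] {k : ℕ} (f : Level rk k → ℝ) :
    f ∈ pencilSpace rk k k := by
  classical
  have : Finite (Level rk k) := Subtype.finite
  have := Fintype.ofFinite (Level rk k)
  -- Comparable elements of equal rank coincide, so the `k`-pencils on level `k` are the point
  -- masses.
  have key : f = ∑ I : Level rk k, f I • pencil rk k I.1 := by
    funext K
    rw [Finset.sum_apply, Finset.sum_eq_single K]
    · simp [pencil]
    · intro I _ hne
      have : ¬ I.1 ≤ K.1 := fun hle => by
        have h1 := h.strictMono (lt_of_le_of_ne hle fun heq => hne (Subtype.ext heq))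
        have h2 := I.2
        have h3 := K.2
        omega
      simp [pencil, this]
    · simp
  rw [key]
  exact Submodule.sum_mem _ fun I _ => Submodule.smul_mem _ _ (Submodule.subset_span ⟨I, rfl⟩)

open Classical in
theorem degree_dualize [Finite V] (h : PointRank rk pt N)
    (he : ∀ U, rk (OrderDual.ofDual (e U)) + rk U = n) {k : ℕ} (hk : k ≤ n)
    (f : Level rk k → ℝ) :
    degree rk n (n - k) (dualize e he hk f) = degree rk n k f := by
  have hset : {t | t ≤ min (n - k) (n - (n - k)) ∧ dualize e he hk f ∈ pencilSpace rk t (n - k)} =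
      {t | t ≤ min k (n - k) ∧ f ∈ pencilSpace rk t k} := by
    ext t
    rw [Set.mem_ofPred_eq, Set.mem_ofPred_eq, Nat.sub_sub_self hk, min_comm]
    exact and_congr_right fun ht => h.dualize_mem_iff he hk ht f
  have hzero : dualize e he hk f = 0 ↔ f = 0 :=
    (dualize_bijective he hk).injective.eq_iff' rfl
  rw [degree, degree, hset]
  exact if_congr hzero rfl rfl

theorem pencilSpace_dual [Finite V] [Finite L] (h : PointRank rk pt N)
    (he : ∀ U, rk (OrderDual.ofDual (e U)) + rk U = n) (k : ℕ) (hk : k ≤ n) :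
    (∀ i : ℕ, i ≤ min k (n - k) →
      dualize e he hk '' (pencilSpace rk i k : Set (Level rk k → ℝ)) =
        (pencilSpace rk i (n - k) : Set (Level rk (n - k) → ℝ))) ∧
    (∀ f : Level rk k → ℝ,
      (∃ t : ℕ, t ≤ min k (n - k) ∧ f ∈ pencilSpace rk t k) ∧
      degree rk n (n - k) (dualize e he hk f) = degree rk n k f) := by
  refine ⟨fun i hi => ?_, fun f => ⟨⟨min k (n - k), le_rfl, ?_⟩, h.degree_dualize he hk f⟩⟩
  · have : (pencilSpace rk i k : Set (Level rk k → ℝ)) =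
        dualize e he hk ⁻¹' (pencilSpace rk i (n - k) : Set (Level rk (n - k) → ℝ)) :=
      Set.ext fun f => (h.dualize_mem_iff he hk hi f).symm
    rw [this, Set.image_preimage_eq _ (dualize_bijective he hk).surjective]
  · rcases le_total k (n - k) with hle | hle
    · rw [min_eq_left hle]
      exact h.mem_pencilSpace_self f
    -- For `k ≥ n - k`, dualizing moves `f` to level `n - k`, where the pencils of rank `n - k` span
    -- everything.
    · rw [← h.dualize_mem_iff he hk le_rfl, min_eq_right hle]
      exact h.mem_pencilSpace_self _

end PointRank
end

/-! ### The subset and subspace lattices -/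

theorem pointRank_cardRk (V : Type*) [DecidableEq V] :
    PointRank (cardRk V) (fun v : V => ({v} : Finset V)) id where
  modular := Finset.card_union_add_card_inter
  strictMono := Finset.card_strictMono
  bot := Finset.card_empty
  pt_le_one v := (Finset.card_singleton v).le
  exists_pt A B hAB := by
    obtain ⟨v, hv, hv'⟩ := Finset.exists_of_ssubset hAB
    exact ⟨v, Finset.singleton_subset_iff.2 hv, fun hle => hv' (Finset.singleton_subset_iff.1 hle)⟩
  card K := by
    simp [cardRk]
  strictMono_card := strictMono_id

/-- Points are indexed by all vectors, so that the count is simply a power of `Nat.card F`; the zero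
vector gives `⊥`, hence only rank at most 1 is required of points. -/
theorem pointRank_dimRk (F V : Type*) [Field F] [Finite F] [AddCommGroup V] [Module F V]
    [FiniteDimensional F V] :
    PointRank (dimRk F V) (fun v : V => Submodule.span F {v}) (fun r => Nat.card F ^ r) where
  modular A B := Submodule.finrank_sup_add_finrank_inf_eq A B
  strictMono _ _ := Submodule.finrank_lt_finrank_of_lt
  bot := finrank_bot F V
  pt_le_one v := by
    simpa [dimRk] using finrank_span_le_card (R := F) ({v} : Set V)
  exists_pt A B hAB := by
    obtain ⟨v, hv, hv'⟩ := SetLike.exists_of_lt hAB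
    exact ⟨v, (Submodule.span_singleton_le_iff_mem v B).2 hv,
      fun hle => hv' ((Submodule.span_singleton_le_iff_mem v A).1 hle)⟩
  card K := by
    simp only [Submodule.span_singleton_le_iff_mem]
    exact Module.natCard_eq_pow_finrank (K := F) (V := K)
  strictMono_card := fun _ _ => Nat.pow_lt_pow_right Finite.one_lt_card

end DegreeDual
open DegreeDual in
theorem theorem5p4 :
    -- the set case
    (∀ (V : Type*) [Fintype V] (perp : Finset V ≃o (Finset V)ᵒᵈ)
      (k : ℕ) (hk : k ≤ Fintype.card V),
      (∀ i : ℕ, i ≤ min k (Fintype.card V - k) →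
        dualize (rk := cardRk V) perp (card_perp perp) hk ''
            (pencilSpace (cardRk V) i k : Set (Level (cardRk V) k → ℝ))
          = (pencilSpace (cardRk V) i (Fintype.card V - k) :
              Set (Level (cardRk V) (Fintype.card V - k) → ℝ))) ∧
      (∀ f : Level (cardRk V) k → ℝ,
        (∃ t : ℕ, t ≤ min k (Fintype.card V - k) ∧ f ∈ pencilSpace (cardRk V) t k) ∧
        degree (cardRk V) (Fintype.card V) (Fintype.card V - k)
            (dualize (rk := cardRk V) perp (card_perp perp) hk f)
          = degree (cardRk V) (Fintype.card V) k f)) ∧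
    -- the q-analog case
    (∀ (F : Type*) [Field F] [Finite F] (V : Type*) [AddCommGroup V] [Module F V]
      [FiniteDimensional F V] (perp : Submodule F V ≃o (Submodule F V)ᵒᵈ)
      (k : ℕ) (hk : k ≤ Module.finrank F V),
      (∀ i : ℕ, i ≤ min k (Module.finrank F V - k) →
        dualize (rk := dimRk F V) perp (finrank_perp perp) hk ''
            (pencilSpace (dimRk F V) i k : Set (Level (dimRk F V) k → ℝ))
          = (pencilSpace (dimRk F V) i (Module.finrank F V - k) :
              Set (Level (dimRk F V) (Module.finrank F V - k) → ℝ))) ∧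
      (∀ f : Level (dimRk F V) k → ℝ,
        (∃ t : ℕ, t ≤ min k (Module.finrank F V - k) ∧ f ∈ pencilSpace (dimRk F V) t k) ∧
        degree (dimRk F V) (Module.finrank F V) (Module.finrank F V - k)
            (dualize (rk := dimRk F V) perp (finrank_perp perp) hk f)
          = degree (dimRk F V) (Module.finrank F V) k f)) := by
  classical
  refine ⟨fun V _ perp k hk => ?_, fun F _ _ V _ _ _ perp k hk => ?_⟩
  · exact (pointRank_cardRk V).pencilSpace_dual (card_perp perp) k hk
  · have : Finite V := Module.finite_of_finite F
    exact (pointRank_dimRk F V).pencilSpace_dual (finrank_perp perp) k hk
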